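/- Let $F$ be an algebraically closed field of characteristic different from $2$, and let $R=F[[x,y]]/(x^2)$ be the $A_\infty$ plane singularity, a complete local noetherian ring of Krull dimension $1$. An $R$-module $N$ is called Cohen–Macaulay (CM) if $\operatorname{Ext}^i_R(F,N)=0$ for all $0\le i<\dim R$. The radical $\mathrm{rad}$ of the category of finitely generated CM-modules over $R$ is the two-sided ideal of all morphisms $f\colon M\to N$ between finitely generated CM-modules such that, for every indecomposable finitely generated CM-module $K$, no composition $K\to M\xrightarrow{f} N\to K$ is invertible in $\operatorname{End}(K)$. Finite powers $\mathrm{rad}^n$ ($n\ge 1$) are the usual powers of an ideal (finite sums of compositions of $n$ morphisms from $\mathrm{rad}$). For a limit ordinal $\lambda$ put $\mathrm{rad}^\lambda=\bigcap_{1\le\mu<\lambda}\mathrm{rad}^\mu$, and for a limit ordinal $\mu$ and an integer $m\ge 1$ put $\mathrm{rad}^{\mu+m}=(\mathrm{rad}^\mu)^{m+1}$. The nilpotency index of the radical is the least ordinal $\lambda\geq 1$ with $\mathrm{rad}^\lambda=0$, if one exists. Theorem 8.4. The nilpotency index of the radical of the category of finitely generated CM-modules over $R$ equals $\omega+2$.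 That is, $\mathrm{rad}^{\omega+1}=(\mathrm{rad}^\omega)^2$ is nonzero, but $\mathrm{rad}^{\omega+2}=0$. -/

import Mathlib

open CategoryTheory

universe v u

noncomputable section

namespace AInfinity

/-! ### Powers of classes of morphisms in a preadditive category -/

section Powers

variable {C : Type u} [Category.{v} C] [Preadditive C]

/-- The product `I J` of two classes of morphisms in a preadditive category: it consists of the
finite sums of composites `X ⟶ Z ⟶ Y` whose first map lies in `J` and whose second map lies
in `I`. -/
def idealMul (I J : MorphismProperty C) : MorphismProperty C := fun X Y f =>
  f ∈ AddSubgroup.closure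
    {h : X ⟶ Y | ∃ (Z : C) (g : X ⟶ Z) (k : Z ⟶ Y), J g ∧ I k ∧ g ≫ k = h}

/-- Finite powers of a class of morphisms; the zeroth power consists of all morphisms. -/
def idealPow (I : MorphismProperty C) : ℕ → MorphismProperty C
  | 0 => ⊤
  | 1 => I
  | n + 2 => idealMul (idealPow I (n + 1)) I

/-- Every ordinal is `l = ω * (l / ω) + m` with `m` finite; this is `m`. -/
def finitePart (l : Ordinal.{0}) : ℕ := Cardinal.toNat (l % Ordinal.omega0).card

open Classical in
/-- The transfinite powers of a class `I` of morphisms. Finite powers are the usual ones; for a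
limit ordinal `l`, the power `I ^ l` is the intersection of all `I ^ k` with `k < l`; and for a
limit ordinal `k` and a positive natural number `m`, `I ^ (k + m)` is `(I ^ k) ^ (m + 1)`. -/
def ordinalPow (I : MorphismProperty C) (l : Ordinal.{0}) : MorphismProperty C :=
  if l < Ordinal.omega0 then idealPow I (finitePart l)
  else if _h : l % Ordinal.omega0 = 0 then ⨅ k : Set.Iio l, ordinalPow I k.1
  else idealPow (ordinalPow I (Ordinal.omega0 * (l / Ordinal.omega0))) (finitePart l + 1)
termination_by l
decreasing_by
  · exact k.2
  · conv_rhs => rw [← Ordinal.div_add_mod l Ordinal.omega0]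
    exact lt_add_of_pos_right _ (pos_iff_ne_zero.2 _h)

/-- A class of morphisms is zero if it contains no nonzero morphism. -/
def IsZeroClass (I : MorphismProperty C) : Prop := ∀ ⦃X Y : C⦄ (f : X ⟶ Y), I f → f = 0

/-- `l` is the least ordinal such that `I ^ l` is zero. -/
def HasNilpotencyIndex (I : MorphismProperty C) (l : Ordinal.{0}) : Prop :=
  IsLeast {k : Ordinal.{0} | IsZeroClass (ordinalPow I k)} l

theorem finitePart_add (k : Ordinal.{0}) (m : ℕ) (hk : k % Ordinal.omega0 = 0) :
    finitePart (k + m) = m := by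
  have hd := Ordinal.dvd_of_mod_eq_zero hk
  obtain ⟨q, rfl⟩ := hd
  rw [finitePart, Ordinal.mul_add_mod_self, Ordinal.mod_eq_of_lt (Ordinal.natCast_lt_omega0 m)]
  simp

theorem ordinalPow_natCast (I : MorphismProperty C) (n : ℕ) :
    ordinalPow I n = idealPow I n := by
  rw [ordinalPow, if_pos (Ordinal.natCast_lt_omega0 n)]
  have := finitePart_add 0 n (by simp)
  rw [zero_add] at this
  rw [this]

theorem mod_omega0_of_isSuccLimit {l : Ordinal.{0}} (hl : Order.IsSuccLimit l) :
    l % Ordinal.omega0 = 0 :=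
  Ordinal.mod_eq_zero_of_dvd (Ordinal.isSuccPrelimit_iff_omega0_dvd.1 hl.isSuccPrelimit)

theorem ordinalPow_limit (I : MorphismProperty C) {l : Ordinal.{0}} (hl : Order.IsSuccLimit l) :
    ordinalPow I l = ⨅ k : Set.Iio l, ordinalPow I k.1 := by
  rw [ordinalPow, if_neg (not_lt.2 (Ordinal.omega0_le_of_isSuccLimit hl)),
    dif_pos (mod_omega0_of_isSuccLimit hl)]

theorem ordinalPow_limit_add (I : MorphismProperty C) {k : Ordinal.{0}}
    (hk : Order.IsSuccLimit k) (m : ℕ) :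
    ordinalPow I (k + m) = idealPow (ordinalPow I k) (m + 1) := by
  rcases Nat.eq_zero_or_pos m with rfl | hm
  · simp [idealPow]
  have h0 := mod_omega0_of_isSuccLimit hk
  have hf := finitePart_add k m h0
  have hd : Ordinal.omega0 * ((k + m) / Ordinal.omega0) = k := by
    obtain ⟨q, rfl⟩ := Ordinal.dvd_of_mod_eq_zero h0
    rw [Ordinal.mul_add_div _ Ordinal.omega0_ne_zero,
      Ordinal.div_eq_zero_of_lt (Ordinal.natCast_lt_omega0 m), add_zero]
  have hne : (k + m) % Ordinal.omega0 ≠ 0 := by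
    intro h
    have := hf
    rw [finitePart, h] at this
    simp at this
    omega
  rw [ordinalPow, if_neg (not_lt.2 ((Ordinal.omega0_le_of_isSuccLimit hk).trans le_self_add)),
    dif_neg hne, hf, hd]

end Powers

/-! ### Maximal Cohen-Macaulay modules over a local ring and the radical of their category -/

section CM

variable (S : Type u) [CommRing S] [IsLocalRing S]

/-- An `S`-module `M` is maximal Cohen-Macaulay if `Ext^i(k, M) = 0` for all `0 ≤ i < dim S`,
where `k` is the residue field of the local ring `S`. -/
def IsMaximalCM (M : ModuleCat.{u} S) : Prop :=
  ∀ i : ℕ, (i : WithBot ℕ∞) < ringKrullDim S →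
    Subsingleton (Abelian.Ext (ModuleCat.of S (IsLocalRing.ResidueField S)) M i)

/-- The property of being a finitely generated maximal Cohen-Macaulay module. -/
def isFGCM : ObjectProperty (ModuleCat.{u} S) := fun M => Module.Finite S M ∧ IsMaximalCM S M

/-- The category of finitely generated maximal Cohen-Macaulay `S`-modules, a full subcategory of
the category of `S`-modules. -/
abbrev FGCM : Type (u + 1) := (isFGCM S).FullSubcategory

/-- The radical of the category of finitely generated Cohen-Macaulay modules: a morphism
`f : M ⟶ N` belongs to it if no composite `K ⟶ M ⟶ N ⟶ K` through `f`, with `K` an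
indecomposable finitely generated Cohen-Macaulay module, is invertible. -/
def rad : MorphismProperty (FGCM S) := fun M N f =>
  ∀ K : FGCM S, Indecomposable K.obj → ∀ (g : K ⟶ M) (h : N ⟶ K), ¬ IsIso (g ≫ f ≫ h)

end CM

/-! ### The one-dimensional `A_∞` plane singularity -/

section Ring

variable (F : Type u) [Field F]

/-- The ring `F[[x, y]] / (x ^ 2)`; here `x` and `y` are the variables `0` and `1`. -/
abbrev AInfRing : Type u :=
  MvPowerSeries (Fin 2) F ⧸ Ideal.span {(MvPowerSeries.X 0 : MvPowerSeries (Fin 2) F) ^ 2}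

instance : IsLocalRing (AInfRing F) := by
  have : Nontrivial (AInfRing F) := by
    refine Ideal.Quotient.nontrivial_iff.2 fun h => ?_
    rw [Ideal.span_singleton_eq_top] at h
    have h' := h.map (MvPowerSeries.constantCoeff (σ := Fin 2) (R := F))
    simp at h'
  exact IsLocalRing.of_surjective' (Ideal.Quotient.mk _) Ideal.Quotient.mk_surjective

end Ring

end AInfinity

end

/-!
The ring `R = F⟦x, y⟧ / (x ^ 2)` is the ring of dual numbers `S[ε]` over the discrete valuation ring
`S = F⟦y⟧`, with `x` as `ε`. As `R` has dimension one, a finite `R`-module is Cohen-Macaulay if and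
only if it has zero socle, which means that it is torsion-free, hence free, over `S`
(`isMaximalCM_iff_isTorsionFree`). The Smith normal form of `εM ⊆ ker ε` decomposes such a module
into copies of `Line e`, which is `S` with `ε = 0`, and of the modules `Plane e a` with `a ≠ 0`, which
are `S × S` with `ε (u, v) = (a * v, 0)` (`exists_sum_linearMap_comp_eq`). These modules have only
trivial idempotents, so a morphism between two of them lies in the radical if and only if it is not
an isomorphism (`rad_of_not_isIso`, `not_isIso_of_rad`).

A homomorphism `Plane e a → Plane e b` is an upper triangular matrix. The product of its diagonal
entries is multiplicative, is a unit only for isomorphisms, and vanishes for maps through `Line e`.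
Hence for a uniformizer `ϖ` it is divisible by `ϖ ^ n` on the `n`-th power of the radical
(`IsDivisible.of_idealPow`), and the diagonal is zero on the `ω`-th power. In other words, a morphism
in the `ω`-th power shifts the three-step filtration of every module `M` that consists of `M`, the
kernel of `ε` and the saturation of `εM` (`ShiftsFiltration.of_forall_idealPow`), so that a product
of three such morphisms is zero.

On the other hand the projection `Plane e a → Line e` and the inclusion `Line e → Plane e b` lie in
the `ω`-th power, since they factor through arbitrarily long chains of radical morphisms
between modules `Plane e c` (`idealPow_toLine_comp`, `idealPow_toPlane`). Their composite
`(u, v) ↦ (v, 0)` is not zero and lies in the square of the `ω`-th power.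
-/

noncomputable section

namespace AInfinity

/-! ### The ring as dual numbers over a discrete valuation ring -/

section DualNumbers

theorem coeff_toMvPowerSeries_one (F : Type u) [CommRing F] (s : PowerSeries F)
    (m : Fin 2 →₀ ℕ) :
    MvPowerSeries.coeff m (PowerSeries.toMvPowerSeries (1 : Fin 2) s) =
      if m 0 = 0 then PowerSeries.coeff (m 1) s else 0 := by
  rw [PowerSeries.toMvPowerSeries_apply]
  split_ifs with h
  · have hm : m = Finsupp.embDomain (Function.Embedding.punit (1 : Fin 2))
        (Finsupp.single () (m 1)) := by
      ext i
      rw [Finsupp.embDomain_single, show Function.Embedding.punit (1 : Fin 2) () = 1 from rfl]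
      fin_cases i <;> simp [h]
    have := MvPowerSeries.coeff_embDomain_rename (Function.Embedding.punit (1 : Fin 2)) s
      (Finsupp.single () (m 1))
    rw [← hm] at this
    exact this
  · refine MvPowerSeries.coeff_rename_eq_zero _ _ ?_
    rintro ⟨n, rfl⟩
    refine h (Finsupp.mapDomain_of_notMem_range _ _ ?_)
    rintro ⟨_, h⟩
    simp at h

theorem coeff_mul_X_zero (F : Type u) [CommRing F] (p : MvPowerSeries (Fin 2) F) (n : ℕ) :
    (MvPowerSeries.coeff (Finsupp.single 1 n) (p * MvPowerSeries.X 0) = 0) ∧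
    (MvPowerSeries.coeff (Finsupp.single 1 n + Finsupp.single 0 1) (p * MvPowerSeries.X 0) =
      MvPowerSeries.coeff (Finsupp.single 1 n) p) := by
  constructor
  · rw [MvPowerSeries.X, MvPowerSeries.coeff_mul_monomial, if_neg]
    intro h
    simpa using h 0
  · rw [MvPowerSeries.X, MvPowerSeries.coeff_add_mul_monomial, mul_one]

/-- Sending `y` to the uniformizer and `x` to `ε` identifies `F⟦x, y⟧ / (x ^ 2)` with the dual
numbers over the discrete valuation ring `F⟦y⟧`. -/
theorem exists_algEquiv_dualNumber (F : Type u) [Field F] :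
    ∃ _ : Algebra (PowerSeries F) (AInfRing F),
      Nonempty (AInfRing F ≃ₐ[PowerSeries F] DualNumber (PowerSeries F)) := by
  let I : Ideal (MvPowerSeries (Fin 2) F) := Ideal.span {(MvPowerSeries.X 0) ^ 2}
  let ι : PowerSeries F →+* AInfRing F :=
    (Ideal.Quotient.mk I).comp (PowerSeries.toMvPowerSeries (1 : Fin 2)).toRingHom
  let _ : Algebra (PowerSeries F) (AInfRing F) := ι.toAlgebra
  have hι (s) : algebraMap (PowerSeries F) (AInfRing F) s =
      Ideal.Quotient.mk I (PowerSeries.toMvPowerSeries (1 : Fin 2) s) := rfl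
  let x : AInfRing F := Ideal.Quotient.mk I (MvPowerSeries.X 0)
  have hx : x * x = 0 := by
    rw [← map_mul, ← pow_two]
    exact Ideal.Quotient.eq_zero_iff_mem.2 (Ideal.subset_span rfl)
  let f : DualNumber (PowerSeries F) →ₐ[PowerSeries F] AInfRing F :=
    DualNumber.lift ⟨(Algebra.ofId _ _, x), hx, fun _ => Commute.all _ _⟩
  have hf (z : DualNumber (PowerSeries F)) : f z = Ideal.Quotient.mk I
      (PowerSeries.toMvPowerSeries (1 : Fin 2) z.fst +
        PowerSeries.toMvPowerSeries (1 : Fin 2) z.snd * MvPowerSeries.X 0) := by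
    rw [DualNumber.lift_apply_apply, map_add, map_mul]
    rfl
  refine ⟨inferInstance, ⟨(AlgEquiv.ofBijective f ⟨?_, ?_⟩).symm⟩⟩
  · rw [injective_iff_map_eq_zero]
    intro z hz
    rw [hf, Ideal.Quotient.eq_zero_iff_mem, Ideal.mem_span_singleton,
      MvPowerSeries.X_pow_dvd_iff] at hz
    ext n
    · have := hz (Finsupp.single 1 n) (by simp)
      rw [map_add, (coeff_mul_X_zero F _ n).1, coeff_toMvPowerSeries_one] at this
      simpa using this
    · have := hz (Finsupp.single 1 n + Finsupp.single 0 1) (by simp)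
      rw [map_add, (coeff_mul_X_zero F _ n).2, coeff_toMvPowerSeries_one,
        coeff_toMvPowerSeries_one] at this
      simpa using this
  · intro r
    obtain ⟨p, rfl⟩ := Ideal.Quotient.mk_surjective r
    refine ⟨TrivSqZeroExt.inl
        (PowerSeries.mk fun n => MvPowerSeries.coeff (Finsupp.single 1 n) p) +
      TrivSqZeroExt.inr
        (PowerSeries.mk fun n =>
          MvPowerSeries.coeff (Finsupp.single 1 n + Finsupp.single 0 1) p), ?_⟩
    rw [hf, Ideal.Quotient.mk_eq_mk_iff_sub_mem, Ideal.mem_span_singleton,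
      MvPowerSeries.X_pow_dvd_iff]
    intro m hm
    have h01 : m 0 = 0 ∨ m 0 = 1 := by omega
    obtain h | h := h01
    · have hm : m = Finsupp.single 1 (m 1) := by
        ext i
        fin_cases i <;> simp [h]
      rw [hm, map_sub, map_add, (coeff_mul_X_zero F _ _).1, coeff_toMvPowerSeries_one]
      simp
    · have hm : m = Finsupp.single 1 (m 1) + Finsupp.single 0 1 := by
        ext i
        fin_cases i <;> simp [h]
      rw [hm, map_sub, map_add, (coeff_mul_X_zero F _ _).2, coeff_toMvPowerSeries_one,
        coeff_toMvPowerSeries_one]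
      simp

variable {S R : Type u} [CommRing S] [CommRing R] [Algebra S R]

theorem isUnit_iff_isUnit_fst (e : R ≃ₐ[S] DualNumber S) (r : R) : IsUnit r ↔ IsUnit (e r).fst := by
  rw [← TrivSqZeroExt.isUnit_iff_isUnit_fst]
  exact (MulEquiv.isUnit_map e).symm

/-- The dual numbers have the same dimension as their base, since `ε` is nilpotent. -/
theorem ringKrullDim_eq_of_algEquiv_dualNumber (e : R ≃ₐ[S] DualNumber S) :
    ringKrullDim R = ringKrullDim S := by
  let f : R →+* S := (TrivSqZeroExt.fstHom S S S).toRingHom.comp e.toRingEquiv.toRingHom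
  have hf : Function.Surjective f := fun s => ⟨e.symm (TrivSqZeroExt.inl s), by simp [f]⟩
  have hker : (RingHom.ker f : Set R) ⊆ nilradical R := by
    intro r hr
    have hr0 : (e r).fst = 0 := hr
    refine ⟨2, ?_⟩
    apply e.injective
    rw [pow_two, map_mul, map_zero]
    ext <;> simp [hr0]
  rw [← ringKrullDim_eq_of_ringEquiv (RingHom.quotientKerEquivOfSurjective hf),
    ringKrullDim_quotient, (PrimeSpectrum.zeroLocus_eq_univ_iff _).2 hker]
  exact (Order.krullDim_eq_of_orderIso OrderIso.Set.univ).symm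

end DualNumbers

/-! ### The modules `S` and `S × S` over dual numbers -/

section Modules

variable {S R : Type u} [CommRing S] [CommRing R] [Algebra S R]

/-- The element `x` of `R` that corresponds to the dual number `ε`. -/
def eps (e : R ≃ₐ[S] DualNumber S) : R := e.symm DualNumber.eps

theorem eps_mul_eps (e : R ≃ₐ[S] DualNumber S) : eps e * eps e = 0 := by
  rw [eps, ← map_mul, DualNumber.eps_mul_eps, map_zero]

theorem smul_eq_fst_smul_add (e : R ≃ₐ[S] DualNumber S) {M : Type*} [AddCommGroup M] [Module S M]
    [Module R M] [IsScalarTower S R M] (r : R) (m : M) :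
    r • m = (e r).fst • m + (e r).snd • eps e • m := by
  have hr : r = (e r).fst • (1 : R) + (e r).snd • eps e := by
    apply e.injective
    rw [map_add, map_smul, map_smul, map_one, eps, AlgEquiv.apply_symm_apply]
    ext <;> simp
  conv_lhs => rw [hr]
  rw [add_smul, smul_assoc, smul_assoc, one_smul]

/-- An `S`-linear map between modules over `S[ε]` is `S[ε]`-linear if it commutes with `ε`. -/
def linearMapOfEps (e : R ≃ₐ[S] DualNumber S) {M N : Type*} [AddCommGroup M] [Module S M]
    [Module R M] [IsScalarTower S R M] [AddCommGroup N] [Module S N]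
    [Module R N] [IsScalarTower S R N] (f : M →ₗ[S] N)
    (hf : ∀ m, f (eps e • m) = eps e • f m) : M →ₗ[R] N where
  toFun := f
  map_add' := map_add f
  map_smul' r m := by
    rw [RingHom.id_apply, smul_eq_fst_smul_add e, smul_eq_fst_smul_add e r (f m), map_add,
      map_smul, map_smul, hf]

/-- The `R`-module `S` on which `ε` acts as zero. -/
def Line (_ : R ≃ₐ[S] DualNumber S) : Type u := S

/-- The `R`-module `S × S` on which `ε` acts by `(u, v) ↦ (a * v, 0)`. For `a ≠ 0` it is isomorphic
to the ideal of `S[ε]` generated by `ε` and `a`. -/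
def Plane (_ : R ≃ₐ[S] DualNumber S) (_ : S) : Type u := S × S

/-- An element of `S` as an element of `Line e`. -/
def Line.mk {e : R ≃ₐ[S] DualNumber S} (s : S) : Line e := s

/-- A pair of elements of `S` as an element of `Plane e a`. -/
def Plane.mk {e : R ≃ₐ[S] DualNumber S} {a : S} (p : S × S) : Plane e a := p

variable (e : R ≃ₐ[S] DualNumber S) (a : S)

instance : AddCommGroup (Line e) := inferInstanceAs (AddCommGroup S)
instance : Module S (Line e) := inferInstanceAs (Module S S)
instance : Module.Finite S (Line e) := inferInstanceAs (Module.Finite S S)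
instance : AddCommGroup (Plane e a) := inferInstanceAs (AddCommGroup (S × S))
instance : Module S (Plane e a) := inferInstanceAs (Module S (S × S))
instance : Module.Finite S (Plane e a) := inferInstanceAs (Module.Finite S (S × S))

instance : Module R (Line e) :=
  Module.compHom (Line e) ((TrivSqZeroExt.fstHom S S S).toRingHom.comp e.toRingEquiv.toRingHom)

theorem Line.smul_def (r : R) (s : Line e) : r • s = (e r).fst • s := rfl

instance : IsScalarTower S R (Line e) :=
  ⟨fun s r m => by
    have h : (e (s • r)).fst = s * (e r).fst := by simp
    rw [Line.smul_def, h, mul_smul, Line.smul_def]⟩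

instance : Module R (Plane e a) where
  smul r p := ((e r).fst * p.1 + (e r).snd * (a * p.2), (e r).fst * p.2)
  one_smul p := by
    refine Prod.ext ?_ ?_
    · change (e 1).fst * p.1 + (e 1).snd * (a * p.2) = p.1
      simp
    · change (e 1).fst * p.2 = p.2
      simp
  mul_smul r s p := by
    refine Prod.ext ?_ ?_
    · change (e (r * s)).fst * p.1 + (e (r * s)).snd * (a * p.2) =
        (e r).fst * ((e s).fst * p.1 + (e s).snd * (a * p.2)) +
          (e r).snd * (a * ((e s).fst * p.2))
      rw [map_mul, TrivSqZeroExt.fst_mul, DualNumber.snd_mul]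
      ring
    · change (e (r * s)).fst * p.2 = (e r).fst * ((e s).fst * p.2)
      rw [map_mul, TrivSqZeroExt.fst_mul]
      ring
  smul_zero r := by
    refine Prod.ext ?_ ?_
    · change (e r).fst * 0 + (e r).snd * (a * 0) = (0 : S)
      ring
    · change (e r).fst * 0 = (0 : S)
      ring
  smul_add r p q := by
    refine Prod.ext ?_ ?_
    · change (e r).fst * (p.1 + q.1) + (e r).snd * (a * (p.2 + q.2)) =
        ((e r).fst * p.1 + (e r).snd * (a * p.2)) + ((e r).fst * q.1 + (e r).snd * (a * q.2))
      ring
    · change (e r).fst * (p.2 + q.2) = (e r).fst * p.2 + (e r).fst * q.2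
      ring
  add_smul r s p := by
    refine Prod.ext ?_ ?_
    · change (e (r + s)).fst * p.1 + (e (r + s)).snd * (a * p.2) =
        ((e r).fst * p.1 + (e r).snd * (a * p.2)) + ((e s).fst * p.1 + (e s).snd * (a * p.2))
      rw [map_add, TrivSqZeroExt.fst_add, TrivSqZeroExt.snd_add]
      ring
    · change (e (r + s)).fst * p.2 = (e r).fst * p.2 + (e s).fst * p.2
      rw [map_add, TrivSqZeroExt.fst_add]
      ring
  zero_smul p := by
    refine Prod.ext ?_ ?_
    · change (e 0).fst * p.1 + (e 0).snd * (a * p.2) = 0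
      simp
    · change (e 0).fst * p.2 = 0
      simp

theorem Plane.smul_def (r : R) (p : Plane e a) :
    r • p = Plane.mk ((e r).fst * p.1 + (e r).snd * (a * p.2), (e r).fst * p.2) := rfl

instance : IsScalarTower S R (Plane e a) :=
  ⟨fun s r p => by
    have h : (e (s • r)).fst = s * (e r).fst := by simp
    have h' : (e (s • r)).snd = s * (e r).snd := by simp
    rw [Plane.smul_def, h, h']
    refine Prod.ext ?_ ?_
    · change s * (e r).fst * p.1 + s * (e r).snd * (a * p.2) =
        s * ((e r).fst * p.1 + (e r).snd * (a * p.2))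
      ring
    · change s * (e r).fst * p.2 = s * ((e r).fst * p.2)
      ring⟩

instance : Module.Finite R (Line e) := Module.Finite.of_restrictScalars_finite S R _
instance : Module.Finite R (Plane e a) := Module.Finite.of_restrictScalars_finite S R _

@[simp]
theorem Line.eps_smul (s : Line e) : eps e • s = 0 := by
  rw [Line.smul_def, eps, AlgEquiv.apply_symm_apply, DualNumber.fst_eps, zero_smul]

@[simp]
theorem Plane.eps_smul (p : Plane e a) : eps e • p = Plane.mk (a * p.2, 0) := by
  rw [Plane.smul_def, eps, AlgEquiv.apply_symm_apply, DualNumber.fst_eps, DualNumber.snd_eps,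
    zero_mul, zero_mul, zero_add, one_mul]

/-! ### Decomposition of Cohen-Macaulay modules -/

/-- The Smith normal form of the inclusion of `εM` into the kernel of `ε` on `M` writes `M` as a
direct sum of modules `Line e` and `Plane e a` with `a ≠ 0`; only the resulting expression of the
identity of `M` is recorded. -/
theorem exists_sum_linearMap_comp_eq [IsDomain S] [IsPrincipalIdealRing S] (M : Type*)
    [AddCommGroup M] [Module S M] [Module R M] [IsScalarTower S R M]
    [Module.Finite S M] [Module.IsTorsionFree S M] :
    ∃ (n d : ℕ) (a : Fin n → S) (_ : ∀ i, a i ≠ 0) (q : ∀ i, M →ₗ[R] Plane e (a i))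
      (p : ∀ i, Plane e (a i) →ₗ[R] M) (q' : Fin d → M →ₗ[R] Line e)
      (p' : Fin d → Line e →ₗ[R] M),
      ∑ i, (p i) ∘ₗ (q i) + ∑ j, (p' j) ∘ₗ (q' j) = LinearMap.id := by
  let X : M →ₗ[S] M :=
    { toFun := fun m => eps e • m
      map_add' := smul_add _
      map_smul' := fun s m => smul_comm _ _ _ }
  have hX (m) : X m = eps e • m := rfl
  have hXX (m) : X (X m) = 0 := by
    rw [hX, hX, smul_smul, eps_mul_eps, zero_smul]
  let b := Module.Free.chooseBasis S M
  obtain ⟨n, o, hno, bK, bN, a, hab⟩ := Submodule.exists_smith_normal_form_of_le b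
    (LinearMap.range X) (LinearMap.ker X) (by rintro _ ⟨m, rfl⟩; exact hXX m)
  obtain ⟨d, rfl⟩ := Nat.exists_eq_add_of_le hno
  have ha (i) : a i ≠ 0 := by
    intro h
    have := hab i
    rw [h, zero_smul] at this
    exact bN.ne_zero i (Subtype.ext this)
  choose f hf using fun i => (bN i).2
  let c (i : Fin n) : M →ₗ[S] S := bN.coord i ∘ₗ X.rangeRestrict
  have hc (m) : ∑ i, c i m • (bN i : M) = X m := by
    have := congrArg Subtype.val (bN.sum_repr (X.rangeRestrict m))
    rwa [AddSubmonoidClass.coe_finsetSum] at this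
  have hcX (i m) : c i (X m) = 0 := by
    have : X.rangeRestrict (X m) = 0 := Subtype.ext (hXX m)
    simp [c, this]
  let P : M →ₗ[S] M := LinearMap.id - ∑ i, (c i).smulRight (f i)
  have hP (m) : P m = m - ∑ i, c i m • f i := by simp [P]
  let P' : M →ₗ[S] LinearMap.ker X := P.codRestrict _ fun m => by
    rw [LinearMap.mem_ker, hP, map_sub, map_sum, ← hc m, sub_eq_zero]
    refine Finset.sum_congr rfl fun i _ => ?_
    rw [map_smul, hf]
  let k (j) : M →ₗ[S] S := bK.coord j ∘ₗ P'
  have hP'X (m) : P' (X m) = ∑ i, (c i m * a i) • bK (Fin.castLE hno i) := by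
    refine Subtype.ext ?_
    change P (X m) = _
    rw [hP, Finset.sum_eq_zero (fun i _ => by rw [hcX, zero_smul]), sub_zero, ← hc]
    rw [AddSubmonoidClass.coe_finsetSum]
    refine Finset.sum_congr rfl fun i _ => ?_
    rw [hab, smul_smul]
    rfl
  have hk1 (i : Fin n) (m) : k (Fin.castAdd d i) (X m) = a i * c i m := by
    change bK.coord _ (P' (X m)) = _
    rw [hP'X, map_sum, Finset.sum_eq_single i]
    · rw [map_smul]
      simp [Fin.castAdd, mul_comm]
    · intro j _ hj
      rw [map_smul, Module.Basis.coord_apply, Module.Basis.repr_self, Finsupp.single_eq_of_ne,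
        smul_zero]
      intro h
      exact hj (Fin.ext (by simpa using (congrArg Fin.val h).symm))
    · simp
  have hk2 (j : Fin d) (m) : k (Fin.natAdd n j) (X m) = 0 := by
    change bK.coord _ (P' (X m)) = _
    rw [hP'X, map_sum, Finset.sum_eq_zero]
    intro i _
    rw [map_smul, Module.Basis.coord_apply, Module.Basis.repr_self, Finsupp.single_eq_of_ne,
      smul_zero]
    intro h
    have := congrArg Fin.val h
    simp at this
    omega
  refine ⟨n, d, a, ha,
    fun i => linearMapOfEps e (N := Plane e (a i)) ((k (Fin.castAdd d i)).prod (c i)) ?_,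
    fun i => linearMapOfEps e (M := Plane e (a i))
      ((LinearMap.toSpanSingleton S M (bK (Fin.castAdd d i) : M)).coprod
        (LinearMap.toSpanSingleton S M (f i))) ?_,
    fun j => linearMapOfEps e (N := Line e) (k (Fin.natAdd n j)) ?_,
    fun j => linearMapOfEps e (M := Line e)
      (LinearMap.toSpanSingleton S M (bK (Fin.natAdd n j) : M)) ?_, ?_⟩
  · intro m
    rw [Plane.eps_smul]
    exact Prod.ext (hk1 i m) (hcX i m)
  · intro p
    rw [Plane.eps_smul]
    change (a i * p.2) • (bK (Fin.castAdd d i) : M) + (0 : S) • f i =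
      X (p.1 • (bK (Fin.castAdd d i) : M) + p.2 • f i)
    have h0 : X (bK (Fin.castAdd d i) : M) = 0 := (bK (Fin.castAdd d i)).2
    rw [map_add, map_smul, map_smul, hf, hab, h0, smul_zero, zero_add, zero_smul, add_zero,
      smul_smul, mul_comm]
    rfl
  · intro m
    rw [Line.eps_smul]
    exact hk2 j m
  · intro s
    rw [Line.eps_smul]
    change (0 : S) • (bK (Fin.natAdd n j) : M) = X ((id s : S) • (bK (Fin.natAdd n j) : M))
    have h0 : X (bK (Fin.natAdd n j) : M) = 0 := (bK (Fin.natAdd n j)).2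
    rw [map_smul, h0, smul_zero, zero_smul]
  · ext m
    have hm := congrArg Subtype.val (bK.sum_repr (P' m))
    rw [Fin.sum_univ_add, Submodule.coe_add, AddSubmonoidClass.coe_finsetSum,
      AddSubmonoidClass.coe_finsetSum] at hm
    change _ = P m at hm
    rw [hP, eq_sub_iff_add_eq] at hm
    rw [LinearMap.add_apply, LinearMap.sum_apply, LinearMap.sum_apply, LinearMap.id_apply]
    conv_rhs => rw [← hm]
    rw [add_right_comm, ← Finset.sum_add_distrib]
    rfl

end Modules

/-! ### Cohen-Macaulay modules are the torsion-free ones -/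

section CohenMacaulay

open IsLocalRing

/-- In dimension one, being Cohen-Macaulay means having zero socle. -/
theorem isMaximalCM_iff {R : Type u} [CommRing R] [IsLocalRing R] (hR : ringKrullDim R = 1)
    (M : ModuleCat.{u} R) :
    IsMaximalCM R M ↔ ∀ m : M, (∀ r ∈ maximalIdeal R, r • m = 0) → m = 0 := by
  constructor
  · intro h m hm
    have h0 := h 0 (by rw [hR]; exact zero_lt_one)
    have h1 : Subsingleton (ModuleCat.of R (ResidueField R) ⟶ M) :=
      Abelian.Ext.homEquiv₀.symm.subsingleton
    let f : ResidueField R →ₗ[R] M := Submodule.liftQ (maximalIdeal R)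
      (LinearMap.toSpanSingleton R M m) fun r hr => hm r hr
    have hf : ModuleCat.ofHom f = 0 := Subsingleton.elim _ _
    have hf0 : f = 0 := congrArg ModuleCat.Hom.hom hf
    have : f (residue R 1) = (1 : R) • m := rfl
    rw [hf0, one_smul] at this
    exact this.symm
  · intro h i hi
    rw [hR] at hi
    obtain rfl : i = 0 := by
      have : (i : ℕ∞) < 1 := by exact_mod_cast hi
      exact_mod_cast Order.lt_one_iff.1 this
    have : Subsingleton (ModuleCat.of R (ResidueField R) ⟶ M) := by
      refine subsingleton_of_forall_eq 0 fun f => ?_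
      ext t
      refine h _ fun r hr => ?_
      rw [← map_smul]
      have : r • t = 0 := by
        rw [Algebra.smul_def]
        change residue R r * t = 0
        rw [(residue_eq_zero_iff r).2 hr, zero_mul]
      rw [this, map_zero]
    exact Abelian.Ext.homEquiv₀.subsingleton

variable {S R : Type u} [CommRing S] [IsDomain S] [IsDiscreteValuationRing S] [CommRing R]
  [Algebra S R]

theorem ringKrullDim_eq_one_of_algEquiv_dualNumber (e : R ≃ₐ[S] DualNumber S) :
    ringKrullDim R = 1 := by
  rw [ringKrullDim_eq_of_algEquiv_dualNumber e, IsDiscreteValuationRing.ringKrullDim_eq_one]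

variable [IsLocalRing R]

theorem mem_maximalIdeal_iff_dvd (e : R ≃ₐ[S] DualNumber S) {ϖ : S} (hϖ : Irreducible ϖ) (r : R) :
    r ∈ maximalIdeal R ↔ ϖ ∣ (e r).fst := by
  rw [mem_maximalIdeal, mem_nonunits_iff, isUnit_iff_isUnit_fst e, ← mem_nonunits_iff,
    ← mem_maximalIdeal, hϖ.maximalIdeal_eq, Ideal.mem_span_singleton]

theorem isMaximalCM_iff_isTorsionFree (e : R ≃ₐ[S] DualNumber S) (M : ModuleCat.{u} R)
    [Module S M] [IsScalarTower S R M] : IsMaximalCM R M ↔ Module.IsTorsionFree S M := by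
  obtain ⟨ϖ, hϖ⟩ := IsDiscreteValuationRing.exists_irreducible S
  rw [isMaximalCM_iff (ringKrullDim_eq_one_of_algEquiv_dualNumber e)]
  constructor
  · intro h
    have h1 (m : M) (hm : ϖ • m = 0) (hm' : eps e • m = 0) : m = 0 := by
      refine h m fun r hr => ?_
      obtain ⟨t, ht⟩ := (mem_maximalIdeal_iff_dvd e hϖ r).1 hr
      rw [smul_eq_fst_smul_add e, hm', smul_zero, add_zero, ht, mul_comm, mul_smul, hm, smul_zero]
    -- If `ϖ` kills `m`, then both `ϖ` and `ε` kill `εm`, which is therefore zero.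
    have h2 (m : M) (hm : ϖ • m = 0) : m = 0 :=
      h1 m hm (h1 _ (by rw [smul_comm, hm, smul_zero])
        (by rw [smul_smul, eps_mul_eps, zero_smul]))
    have h3 (n : ℕ) (m : M) (hm : ϖ ^ n • m = 0) : m = 0 := by
      induction n with
      | zero => simpa using hm
      | succ n ih =>
        rw [pow_succ', mul_smul] at hm
        exact ih (h2 _ hm)
    refine Module.isTorsionFree_iff_smul_eq_zero.2 fun s m hs => ?_
    by_cases hs0 : s = 0
    · exact Or.inl hs0
    · obtain ⟨n, t, ht⟩ := IsDiscreteValuationRing.associated_pow_irreducible hs0 hϖ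
      refine Or.inr (h3 n m ?_)
      rw [← ht, mul_comm, mul_smul, hs, smul_zero]
  · intro h m hm
    have := hm (algebraMap S R ϖ) ((mem_maximalIdeal_iff_dvd e hϖ _).2 (by
      rw [AlgEquiv.commutes]
      exact dvd_rfl))
    rw [algebraMap_smul] at this
    exact (smul_eq_zero.1 this).resolve_left hϖ.ne_zero

theorem isFGCM_of_isTorsionFree (e : R ≃ₐ[S] DualNumber S) (M : Type u) [AddCommGroup M]
    [Module R M] [Module S M] [IsScalarTower S R M] [Module.Finite R M]
    [Module.IsTorsionFree S M] : isFGCM R (ModuleCat.of R M) :=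
  ⟨inferInstance, (isMaximalCM_iff_isTorsionFree e _).2 inferInstance⟩

variable (e : R ≃ₐ[S] DualNumber S)

instance : Module.IsTorsionFree S (Line e) := inferInstanceAs (Module.IsTorsionFree S S)
instance (a : S) : Module.IsTorsionFree S (Plane e a) :=
  inferInstanceAs (Module.IsTorsionFree S (S × S))

/-- `Line e` as an object of the category of Cohen-Macaulay modules. -/
abbrev lineObj : FGCM R := ⟨ModuleCat.of R (Line e), isFGCM_of_isTorsionFree e _⟩

/-- `Plane e a` as an object of the category of Cohen-Macaulay modules. -/
abbrev planeObj (a : S) : FGCM R := ⟨ModuleCat.of R (Plane e a), isFGCM_of_isTorsionFree e _⟩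

/-- The linear map underlying a morphism of Cohen-Macaulay modules. -/
def toLin {M N : FGCM R} (f : M ⟶ N) : M.obj →ₗ[R] N.obj := f.hom.hom

/-- The morphism of Cohen-Macaulay modules given by a linear map. -/
def ofLin {M N : FGCM R} (f : M.obj →ₗ[R] N.obj) : M ⟶ N := ObjectProperty.homMk (ModuleCat.ofHom f)

@[simp] theorem toLin_comp {M N K : FGCM R} (f : M ⟶ N) (g : N ⟶ K) :
    toLin (f ≫ g) = toLin g ∘ₗ toLin f := rfl

@[simp] theorem toLin_add {M N : FGCM R} (f g : M ⟶ N) : toLin (f + g) = toLin f + toLin g := rfl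

@[simp] theorem toLin_neg {M N : FGCM R} (f : M ⟶ N) : toLin (-f) = -toLin f := rfl

theorem toLin_injective {M N : FGCM R} : Function.Injective (toLin : (M ⟶ N) → _) :=
  fun _ _ h => ObjectProperty.hom_ext _ (ModuleCat.hom_ext h)

theorem toLin_sum {M N : FGCM R} {ι : Type*} (s : Finset ι) (f : ι → (M ⟶ N)) :
    toLin (∑ i ∈ s, f i) = ∑ i ∈ s, toLin (f i) :=
  map_sum (AddMonoidHom.mk' (toLin : (M ⟶ N) → _) toLin_add) f s

theorem isIso_of_bijective {M N : FGCM R} (f : M ⟶ N) (hf : Function.Bijective (toLin f)) :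
    IsIso f :=
  (ObjectProperty.isIso_hom_iff f).1 ((ConcreteCategory.isIso_iff_bijective _).2 hf)

theorem bijective_of_isIso {M N : FGCM R} (f : M ⟶ N) [IsIso f] : Function.Bijective (toLin f) :=
  (ConcreteCategory.isIso_iff_bijective f.hom).1 ((ObjectProperty.isIso_hom_iff f).2 inferInstance)

/-- The endomorphisms of `Z` that factor through `Line e` or through some `Plane e a` with
`a ≠ 0`. -/
def standardFactorizations (Z : FGCM R) : Set (Z ⟶ Z) :=
  {h | (∃ (a : S) (_ : a ≠ 0) (q : Z ⟶ planeObj e a) (p : planeObj e a ⟶ Z), q ≫ p = h) ∨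
    ∃ (q : Z ⟶ lineObj e) (p : lineObj e ⟶ Z), q ≫ p = h}

theorem id_mem_closure_standardFactorizations (Z : FGCM R) :
    𝟙 Z ∈ AddSubgroup.closure (standardFactorizations e Z) := by
  let _ : Module S Z.obj := Module.restrictScalars S R Z.obj
  have : IsScalarTower S R Z.obj := IsScalarTower.restrictScalars S R Z.obj
  have : Module.Finite R Z.obj := Z.property.1
  have : Module.Finite S R :=
    have : Module.Finite S (DualNumber S) := inferInstanceAs (Module.Finite S (S × S))
    Module.Finite.equiv e.symm.toLinearEquiv
  have : Module.Finite S Z.obj := Module.Finite.trans R Z.obj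
  have : Module.IsTorsionFree S Z.obj := (isMaximalCM_iff_isTorsionFree e _).1 Z.property.2
  obtain ⟨n, d, a, ha, q, p, q', p', h⟩ := exists_sum_linearMap_comp_eq e Z.obj
  have hid : 𝟙 Z = ∑ i, (ofLin (q i) : Z ⟶ planeObj e (a i)) ≫ ofLin (p i) +
      ∑ j, (ofLin (q' j) : Z ⟶ lineObj e) ≫ ofLin (p' j) := by
    apply toLin_injective
    rw [toLin_add, toLin_sum, toLin_sum]
    exact h.symm
  rw [hid]
  refine add_mem (sum_mem fun i _ => ?_) (sum_mem fun j _ => ?_)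
  · exact AddSubgroup.subset_closure (Or.inl ⟨a i, ha i, _, _, rfl⟩)
  · exact AddSubgroup.subset_closure (Or.inr ⟨_, _, rfl⟩)

end CohenMacaulay

/-! ### Homomorphisms between the standard modules -/

section StandardHom

variable {S R : Type u} [CommRing S] [CommRing R] [Algebra S R] {e : R ≃ₐ[S] DualNumber S}

namespace Line

/-- The scalar by which an endomorphism of `Line e` acts. -/
def scalar (f : Line e →ₗ[R] Line e) : S := f (Line.mk 1)

theorem apply_eq (f : Line e →ₗ[R] Line e) (s : Line e) : f s = scalar f • s := by
  have h : s = (id s : S) • Line.mk 1 := (mul_one (M := S) s).symm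
  conv_lhs => rw [h, LinearMap.map_smul_of_tower]
  exact mul_comm (G := S) (id s) (scalar f)

theorem scalar_comp (f g : Line e →ₗ[R] Line e) : scalar (g ∘ₗ f) = scalar g * scalar f :=
  apply_eq g (f (Line.mk 1))

end Line

namespace Plane

variable {a b c : S}

/-- The upper diagonal entry of the matrix of a homomorphism `Plane e a → Plane e b`. -/
def upper (f : Plane e a →ₗ[R] Plane e b) : S := (f (mk (1, 0))).1

/-- The lower diagonal entry of the matrix of a homomorphism `Plane e a → Plane e b`. -/
def lower (f : Plane e a →ₗ[R] Plane e b) : S := (f (mk (0, 1))).2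

/-- The upper right entry of the matrix of a homomorphism `Plane e a → Plane e b`. -/
def corner (f : Plane e a →ₗ[R] Plane e b) : S := (f (mk (0, 1))).1

theorem smul_one_zero : a • (mk (1, 0) : Plane e a) = eps e • mk (0, 1) := by
  rw [Plane.eps_smul]
  exact Prod.ext rfl (mul_zero a)

theorem smul_apply_one_zero {M : Type*} [AddCommGroup M] [Module S M] [Module R M]
    [IsScalarTower S R M] (f : Plane e a →ₗ[R] M) :
    a • f (mk (1, 0)) = eps e • f (mk (0, 1)) := by
  rw [← f.map_smul (eps e), ← smul_one_zero, LinearMap.map_smul_of_tower]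

theorem upper_mul (f : Plane e a →ₗ[R] Plane e b) : a * upper f = b * lower f := by
  have h := smul_apply_one_zero f
  rw [Plane.eps_smul] at h
  exact congrArg Prod.fst h

theorem apply_eq_add {M : Type*} [AddCommGroup M] [Module S M] [Module R M]
    [IsScalarTower S R M] (f : Plane e a →ₗ[R] M) (p : Plane e a) :
    f p = p.1 • f (mk (1, 0)) + p.2 • f (mk (0, 1)) := by
  have h : p = p.1 • mk (1, 0) + p.2 • mk (0, 1) := by
    refine Prod.ext ?_ ?_
    · change p.1 = p.1 * 1 + p.2 * 0
      ring
    · change p.2 = p.1 * 0 + p.2 * 1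
      ring
  conv_lhs => rw [h]
  rw [map_add, LinearMap.map_smul_of_tower, LinearMap.map_smul_of_tower]

variable [IsDomain S]

theorem apply_one_zero_snd (ha : a ≠ 0) (f : Plane e a →ₗ[R] Plane e b) :
    (f (mk (1, 0))).2 = 0 := by
  have h := smul_apply_one_zero f
  rw [Plane.eps_smul] at h
  exact (mul_eq_zero.1 (congrArg Prod.snd h)).resolve_left ha

theorem apply_eq (ha : a ≠ 0) (f : Plane e a →ₗ[R] Plane e b) (p : Plane e a) :
    f p = mk (upper f * p.1 + corner f * p.2, lower f * p.2) := by
  rw [apply_eq_add]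
  refine Prod.ext ?_ ?_
  · change p.1 * upper f + p.2 * corner f = upper f * p.1 + corner f * p.2
    ring
  · change p.1 * (f (mk (1, 0))).2 + p.2 * lower f = lower f * p.2
    rw [apply_one_zero_snd ha]
    ring

theorem upper_comp (ha : a ≠ 0) (hb : b ≠ 0) (f : Plane e a →ₗ[R] Plane e b)
    (g : Plane e b →ₗ[R] Plane e c) : upper (g ∘ₗ f) = upper g * upper f := by
  rw [upper, LinearMap.comp_apply, apply_eq hb g, apply_one_zero_snd ha f, mul_zero, add_zero]
  rfl

theorem lower_comp (hb : b ≠ 0) (f : Plane e a →ₗ[R] Plane e b)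
    (g : Plane e b →ₗ[R] Plane e c) : lower (g ∘ₗ f) = lower g * lower f := by
  rw [lower, LinearMap.comp_apply, apply_eq hb g]
  rfl

/-- A homomorphism from `Plane e a` to `Line e` kills the first basis vector. -/
theorem apply_one_zero_line (ha : a ≠ 0) (f : Plane e a →ₗ[R] Line e) :
    f (mk (1, 0)) = 0 := by
  have h := smul_apply_one_zero f
  rw [Line.eps_smul] at h
  exact (smul_eq_zero.1 h).resolve_left ha

/-- A homomorphism from `Line e` to `Plane e b` has image in the kernel of `ε`. -/
theorem line_apply_snd (hb : b ≠ 0) (f : Line e →ₗ[R] Plane e b) (s : Line e) : (f s).2 = 0 := by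
  have h : eps e • f s = 0 := by rw [← map_smul, Line.eps_smul, map_zero]
  rw [Plane.eps_smul] at h
  exact (mul_eq_zero.1 (congrArg Prod.fst h)).resolve_left hb

theorem upper_comp_line (ha : a ≠ 0) (f : Plane e a →ₗ[R] Line e) (g : Line e →ₗ[R] Plane e b) :
    upper (g ∘ₗ f) = 0 := by
  rw [upper, LinearMap.comp_apply, apply_one_zero_line ha, map_zero]
  rfl

theorem scalar_comp (hb : b ≠ 0) (f : Line e →ₗ[R] Plane e b) (g : Plane e b →ₗ[R] Line e) :
    Line.scalar (g ∘ₗ f) = 0 := by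
  rw [Line.scalar, LinearMap.comp_apply, apply_eq_add g, line_apply_snd hb, zero_smul, add_zero,
    apply_one_zero_line hb, smul_zero]
  rfl

theorem bijective_of_isUnit (ha : a ≠ 0) (f : Plane e a →ₗ[R] Plane e b) (h1 : IsUnit (upper f))
    (h2 : IsUnit (lower f)) : Function.Bijective f := by
  constructor
  · rw [injective_iff_map_eq_zero]
    intro p hp
    rw [apply_eq ha] at hp
    have hp2 : p.2 = 0 := h2.mul_right_eq_zero.1 (congrArg Prod.snd hp)
    have hp1 : upper f * p.1 + corner f * p.2 = 0 := congrArg Prod.fst hp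
    rw [hp2, mul_zero, add_zero] at hp1
    exact Prod.ext (h1.mul_right_eq_zero.1 hp1) hp2
  · intro q
    obtain ⟨s, hs⟩ := h2.dvd (a := q.2)
    obtain ⟨t, ht⟩ := h1.dvd (a := q.1 - corner f * s)
    refine ⟨mk (t, s), ?_⟩
    rw [apply_eq ha]
    refine Prod.ext ?_ hs.symm
    change upper f * t + corner f * s = q.1
    rw [← ht, sub_add_cancel]

theorem eq_zero_or_eq_id_of_comp_self (ha : a ≠ 0) (f : Plane e a →ₗ[R] Plane e a)
    (hf : f ∘ₗ f = f) : f = 0 ∨ f = LinearMap.id := by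
  have hul : upper f = lower f := mul_left_cancel₀ ha (upper_mul f)
  have hu : upper f * upper f = upper f := by rw [← upper_comp ha ha, hf]
  have hc : upper f * corner f + corner f * lower f = corner f := by
    have := LinearMap.congr_fun hf (mk (0, 1))
    rw [LinearMap.comp_apply, apply_eq ha f (f _)] at this
    exact congrArg Prod.fst this
  obtain h | h := IsIdempotentElem.iff_eq_zero_or_one.1 hu
  · left
    have hc' : corner f = 0 := by rw [← hc, ← hul, h]; ring
    ext p
    rw [apply_eq ha, ← hul, h, hc']
    refine Prod.ext ?_ ?_
    · change (0 : S) * p.1 + 0 * p.2 = 0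
      ring
    · exact zero_mul _
  · right
    have hc' : corner f = 0 := by
      rw [← hul, h, one_mul, mul_one] at hc
      exact left_eq_add.1 hc.symm
    ext p
    rw [apply_eq ha, ← hul, h, hc']
    refine Prod.ext ?_ ?_
    · change (1 : S) * p.1 + 0 * p.2 = p.1
      ring
    · exact one_mul _

end Plane

theorem Line.eq_zero_or_eq_id_of_comp_self [IsDomain S] (f : Line e →ₗ[R] Line e)
    (hf : f ∘ₗ f = f) : f = 0 ∨ f = LinearMap.id := by
  have hu : scalar f * scalar f = scalar f := by rw [← scalar_comp, hf]
  obtain h | h := IsIdempotentElem.iff_eq_zero_or_one.1 hu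
  · left
    ext s
    rw [Line.apply_eq, h]
    exact zero_smul S s
  · right
    ext s
    rw [Line.apply_eq, h]
    exact one_smul S s

theorem Line.bijective_of_isUnit (f : Line e →ₗ[R] Line e) (hf : IsUnit (scalar f)) :
    Function.Bijective f := by
  constructor
  · rw [injective_iff_map_eq_zero]
    intro s hs
    rw [Line.apply_eq] at hs
    exact hf.smul_eq_zero.1 hs
  · intro t
    obtain ⟨s, hs⟩ := hf.dvd (a := (id t : S))
    refine ⟨Line.mk s, ?_⟩
    rw [Line.apply_eq]
    exact hs.symm

end StandardHom

/-! ### Indecomposability and the radical -/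

section Radical

variable {R : Type u} [CommRing R] [IsLocalRing R]

/-- A nonzero object all of whose idempotent endomorphisms are `0` or `1`. -/
structure HasTrivialIdempotents (K : FGCM R) : Prop where
  id_ne_zero : 𝟙 K ≠ 0
  eq_zero_or_eq_id : ∀ p : K ⟶ K, p ≫ p = p → p = 0 ∨ p = 𝟙 K

open Limits in
theorem HasTrivialIdempotents.indecomposable {K : FGCM R} (hK : HasTrivialIdempotents K) :
    Indecomposable K.obj := by
  refine ⟨fun h => hK.id_ne_zero (ObjectProperty.hom_ext _ (h.eq_of_src _ _)), fun Y Z i => ?_⟩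
  let p : K ⟶ K := ObjectProperty.homMk (i.hom ≫ biprod.fst ≫ biprod.inl ≫ i.inv)
  have hp : p ≫ p = p := ObjectProperty.hom_ext _ (by
    change (i.hom ≫ biprod.fst ≫ biprod.inl ≫ i.inv) ≫
      (i.hom ≫ biprod.fst ≫ biprod.inl ≫ i.inv) = i.hom ≫ biprod.fst ≫ biprod.inl ≫ i.inv
    simp)
  have hp' : (biprod.fst ≫ biprod.inl : Y ⊞ Z ⟶ Y ⊞ Z) = i.inv ≫ p.hom ≫ i.hom := by
    change _ = i.inv ≫ (i.hom ≫ biprod.fst ≫ biprod.inl ≫ i.inv) ≫ i.hom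
    simp
  obtain h | h := hK.eq_zero_or_eq_id p hp
  · left
    have h0 : (biprod.fst ≫ biprod.inl : Y ⊞ Z ⟶ Y ⊞ Z) = 0 := by
      rw [hp', h]
      change i.inv ≫ 0 ≫ i.hom = 0
      simp
    rw [IsZero.iff_id_eq_zero]
    calc 𝟙 Y = biprod.inl ≫ ((biprod.fst : Y ⊞ Z ⟶ Y) ≫ biprod.inl) ≫ biprod.fst := by simp
      _ = 0 := by rw [h0]; simp
  · right
    have h1 : (biprod.fst ≫ biprod.inl : Y ⊞ Z ⟶ Y ⊞ Z) = 𝟙 _ := by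
      rw [hp', h]
      change i.inv ≫ 𝟙 _ ≫ i.hom = _
      simp
    rw [IsZero.iff_id_eq_zero]
    calc 𝟙 Z = biprod.inr ≫ 𝟙 (Y ⊞ Z) ≫ biprod.snd := by simp
      _ = 0 := by rw [← h1]; simp

theorem rad_comp {M N K : FGCM R} (f : M ⟶ N) (g : N ⟶ K) (hf : rad R f) : rad R (f ≫ g) := by
  intro L hL i p
  rw [Category.assoc]
  exact hf L hL i (g ≫ p)

theorem comp_rad {M N K : FGCM R} (f : M ⟶ N) (g : N ⟶ K) (hg : rad R g) : rad R (f ≫ g) := by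
  intro L hL i p
  have := hg L hL (i ≫ f) p
  simpa using this

theorem not_isIso_of_rad {M N : FGCM R} (hM : Indecomposable M.obj) (f : M ⟶ N) (hf : rad R f) :
    ¬ IsIso f := by
  intro h
  refine hf M hM (𝟙 M) (inv f) ?_
  rw [IsIso.hom_inv_id, Category.id_comp]
  infer_instance

/-- A non-isomorphism between objects with trivial idempotents lies in the radical: an invertible
`K ⟶ M ⟶ N ⟶ K` would provide nonzero idempotents on `M` and on `N`, hence an inverse. -/
theorem rad_of_not_isIso {M N : FGCM R} (hM : HasTrivialIdempotents M)
    (hN : HasTrivialIdempotents N) (f : M ⟶ N) (hf : ¬ IsIso f) : rad R f := by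
  intro K hK g h hu
  have hK0 : 𝟙 K ≠ 0 := fun h0 => hK.1 ((Limits.IsZero.iff_id_eq_zero _).2
    (congrArg InducedCategory.Hom.hom h0))
  let w := inv (g ≫ f ≫ h)
  have hw : g ≫ f ≫ h ≫ w = 𝟙 K := by
    have : (g ≫ f ≫ h) ≫ w = 𝟙 K := IsIso.hom_inv_id _
    simpa using this
  have hw' {X : FGCM R} (t : K ⟶ X) : g ≫ f ≫ h ≫ w ≫ t = t := by
    have := congrArg (· ≫ t) hw
    simpa using this
  apply hf
  refine ⟨h ≫ w ≫ g, ?_, ?_⟩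
  · refine (hM.eq_zero_or_eq_id (f ≫ h ≫ w ≫ g) (by simp [hw'])).resolve_left fun h0 => hK0 ?_
    calc 𝟙 K = g ≫ (f ≫ h ≫ w ≫ g) ≫ f ≫ h ≫ w := by simp [hw]
      _ = 0 := by rw [h0]; simp
  · have := hN.eq_zero_or_eq_id (h ≫ w ≫ g ≫ f) (by simp [hw'])
    rw [Category.assoc, Category.assoc]
    refine this.resolve_left fun h0 => hK0 ?_
    calc 𝟙 K = g ≫ f ≫ (h ≫ w ≫ g ≫ f) ≫ h ≫ w := by simp [hw]
      _ = 0 := by rw [h0]; simp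

variable {S : Type u} [CommRing S] [IsDomain S] [IsDiscreteValuationRing S] [Algebra S R]
  (e : R ≃ₐ[S] DualNumber S)

theorem hasTrivialIdempotents_lineObj : HasTrivialIdempotents (lineObj e) where
  id_ne_zero h := by
    have h0 : (LinearMap.id : Line e →ₗ[R] Line e) = 0 := congrArg toLin h
    exact one_ne_zero (α := S) (LinearMap.congr_fun h0 (Line.mk 1))
  eq_zero_or_eq_id p hp :=
    (Line.eq_zero_or_eq_id_of_comp_self (e := e) (toLin p) (congrArg toLin hp)).imp
      (fun h => toLin_injective h) (fun h => toLin_injective h)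

theorem hasTrivialIdempotents_planeObj {a : S} (ha : a ≠ 0) :
    HasTrivialIdempotents (planeObj e a) where
  id_ne_zero h := by
    have h0 : (LinearMap.id : Plane e a →ₗ[R] Plane e a) = 0 := congrArg toLin h
    exact one_ne_zero (α := S) (congrArg Prod.fst (LinearMap.congr_fun h0 (Plane.mk (1, 0))))
  eq_zero_or_eq_id p hp :=
    (Plane.eq_zero_or_eq_id_of_comp_self ha (toLin p) (congrArg toLin hp)).imp
      (fun h => toLin_injective h) (fun h => toLin_injective h)

end Radical

/-! ### Divisibility of the diagonal entries along powers of the radical -/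

section Divisibility

variable {S R : Type u} [CommRing S] [IsDomain S] [IsDiscreteValuationRing S] [CommRing R]
  [Algebra S R] {e : R ≃ₐ[S] DualNumber S}

/-- Divisibility of the product of the diagonal entries is preserved by sums: the two cross terms
of the product for `f + g` coincide, and their square is the product of the terms for `f` and
for `g`. -/
theorem Plane.pow_dvd_upper_mul_lower_add {a b : S} (hb : b ≠ 0) (ϖ : S) (n : ℕ)
    (f g : Plane e a →ₗ[R] Plane e b) (hf : ϖ ^ n ∣ upper f * lower f)
    (hg : ϖ ^ n ∣ upper g * lower g) : ϖ ^ n ∣ upper (f + g) * lower (f + g) := by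
  have hcross : upper f * lower g = upper g * lower f := by
    apply mul_left_cancel₀ hb
    calc b * (upper f * lower g) = upper f * (b * lower g) := by ring
      _ = upper g * (a * upper f) := by rw [← upper_mul]; ring
      _ = b * (upper g * lower f) := by rw [upper_mul]; ring
  have hdvd : ϖ ^ n ∣ upper f * lower g := by
    rw [← IsIntegrallyClosed.pow_dvd_pow_iff two_ne_zero]
    calc (ϖ ^ n) ^ 2 = ϖ ^ n * ϖ ^ n := by ring
      _ ∣ (upper f * lower f) * (upper g * lower g) := mul_dvd_mul hf hg
      _ = (upper f * lower g) * (upper g * lower f) := by ring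
      _ = (upper f * lower g) ^ 2 := by rw [← hcross]; ring
  have hsum : upper (f + g) * lower (f + g) =
      upper f * lower f + upper g * lower g + upper f * lower g + upper g * lower f := by
    change (upper f + upper g) * (lower f + lower g) = _
    ring
  rw [hsum]
  exact dvd_add (dvd_add (dvd_add hf hg) hdvd) (hcross ▸ hdvd)

variable [IsLocalRing R]

variable (e) in
/-- All components of `f` between modules `Plane e a` and `Plane e b` have a product of diagonal
entries divisible by `ϖ ^ n`, and all its components between copies of `Line e` are divisible by
`ϖ ^ n`. The product of the entries is used since it is multiplicative, and is a unit exactly for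
isomorphisms, for all `a` and `b` alike. -/
structure IsDivisible (ϖ : S) (n : ℕ) {M N : FGCM R} (f : M ⟶ N) : Prop where
  plane : ∀ {a b : S}, a ≠ 0 → b ≠ 0 → ∀ (i : planeObj e a ⟶ M) (p : N ⟶ planeObj e b),
    ϖ ^ n ∣ Plane.upper (toLin (i ≫ f ≫ p)) * Plane.lower (toLin (i ≫ f ≫ p))
  line : ∀ (i : lineObj e ⟶ M) (p : N ⟶ lineObj e),
    ϖ ^ n ∣ Line.scalar (toLin (i ≫ f ≫ p))

namespace IsDivisible

variable {ϖ : S} {n : ℕ} {M N K : FGCM R}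

theorem zero : IsDivisible e ϖ n (0 : M ⟶ N) where
  plane _ _ i p := by
    rw [Limits.zero_comp, Limits.comp_zero]
    change _ ∣ (0 : S) * 0
    simp
  line i p := by
    rw [Limits.zero_comp, Limits.comp_zero]
    exact dvd_zero _

theorem add {f g : M ⟶ N} (hf : IsDivisible e ϖ n f) (hg : IsDivisible e ϖ n g) :
    IsDivisible e ϖ n (f + g) where
  plane ha hb i p := by
    rw [Preadditive.add_comp, Preadditive.comp_add, toLin_add]
    exact Plane.pow_dvd_upper_mul_lower_add hb _ _ _ _ (hf.plane ha hb i p) (hg.plane ha hb i p)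
  line i p := by
    rw [Preadditive.add_comp, Preadditive.comp_add, toLin_add]
    exact (dvd_add (hf.line i p) (hg.line i p) : _ ∣ _ + _)

theorem neg {f : M ⟶ N} (hf : IsDivisible e ϖ n f) : IsDivisible e ϖ n (-f) where
  plane ha hb i p := by
    have := hf.plane ha hb i (-p)
    rwa [Preadditive.comp_neg, ← Preadditive.neg_comp] at this
  line i p := by
    have := hf.line i (-p)
    rwa [Preadditive.comp_neg, ← Preadditive.neg_comp] at this

theorem of_mem_closure {s : Set (M ⟶ N)} (hs : ∀ f ∈ s, IsDivisible e ϖ n f) {f : M ⟶ N}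
    (hf : f ∈ AddSubgroup.closure s) : IsDivisible e ϖ n f := by
  induction hf using AddSubgroup.closure_induction with
  | mem f hf => exact hs f hf
  | zero => exact zero
  | add f g _ _ hf hg => exact hf.add hg
  | neg f _ hf => exact hf.neg

/-- Divisibility is additive under composition: the middle object decomposes into standard modules,
and a composite of type `Plane → Line → Plane` or `Line → Plane → Line` has zero diagonal. -/
theorem comp {m : ℕ} {f : M ⟶ N} {g : N ⟶ K} (hf : IsDivisible e ϖ m f)
    (hg : IsDivisible e ϖ n g) : IsDivisible e ϖ (m + n) (f ≫ g) := by
  have key (z : N ⟶ N) (hz : z ∈ AddSubgroup.closure (standardFactorizations e N)) :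
      IsDivisible e ϖ (m + n) (f ≫ z ≫ g) := by
    induction hz using AddSubgroup.closure_induction with
    | zero => simpa using zero
    | add y z _ _ hy hz => simpa using hy.add hz
    | neg z _ hz => simpa using hz.neg
    | mem z hz =>
      obtain ⟨c, hc, q, r, rfl⟩ | ⟨q, r, rfl⟩ := hz
      · refine ⟨fun {a b} ha hb i p => ?_, fun i p => ?_⟩
        · have h : i ≫ (f ≫ (q ≫ r) ≫ g) ≫ p = (i ≫ f ≫ q) ≫ (r ≫ g ≫ p) := by simp
          rw [h, toLin_comp, Plane.upper_comp ha hc, Plane.lower_comp hc,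
            mul_mul_mul_comm, pow_add, mul_comm (ϖ ^ m)]
          exact mul_dvd_mul (hg.plane hc hb r p) (hf.plane ha hc i q)
        · have h : i ≫ (f ≫ (q ≫ r) ≫ g) ≫ p = (i ≫ f ≫ q) ≫ (r ≫ g ≫ p) := by simp
          rw [h, toLin_comp, Plane.scalar_comp hc]
          exact dvd_zero _
      · refine ⟨fun {a b} ha hb i p => ?_, fun i p => ?_⟩
        · have h : i ≫ (f ≫ (q ≫ r) ≫ g) ≫ p = (i ≫ f ≫ q) ≫ (r ≫ g ≫ p) := by simp
          rw [h, toLin_comp, Plane.upper_comp_line ha, zero_mul]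
          exact dvd_zero _
        · have h : i ≫ (f ≫ (q ≫ r) ≫ g) ≫ p = (i ≫ f ≫ q) ≫ (r ≫ g ≫ p) := by simp
          rw [h, toLin_comp, Line.scalar_comp, pow_add, mul_comm (ϖ ^ m)]
          exact mul_dvd_mul (hg.line r p) (hf.line i q)
  simpa using key (𝟙 N) (id_mem_closure_standardFactorizations e N)

theorem of_rad (hϖ : Irreducible ϖ) {f : M ⟶ N} (hf : rad R f) : IsDivisible e ϖ 1 f := by
  have hdvd (s : S) (hs : ¬ IsUnit s) : ϖ ∣ s := by
    rwa [← Ideal.mem_span_singleton, ← hϖ.maximalIdeal_eq, IsLocalRing.mem_maximalIdeal]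
  refine ⟨fun {a b} ha hb i p => ?_, fun i p => ?_⟩
  · rw [pow_one]
    refine hdvd _ fun hu => ?_
    rw [IsUnit.mul_iff] at hu
    exact not_isIso_of_rad (hasTrivialIdempotents_planeObj e ha).indecomposable _
      (comp_rad i _ (rad_comp f p hf))
      (isIso_of_bijective _ (Plane.bijective_of_isUnit ha _ hu.1 hu.2))
  · rw [pow_one]
    refine hdvd _ fun hu => ?_
    refine not_isIso_of_rad (hasTrivialIdempotents_lineObj e).indecomposable _
      (comp_rad i _ (rad_comp f p hf)) (isIso_of_bijective _ ?_)
    exact Line.bijective_of_isUnit (e := e) _ hu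

theorem of_idealPow (hϖ : Irreducible ϖ) {f : M ⟶ N} (hf : idealPow (rad R) (n + 1) f) :
    IsDivisible e ϖ (n + 1) f := by
  induction n generalizing M N with
  | zero => exact of_rad hϖ hf
  | succ n ih =>
    refine of_mem_closure ?_ hf
    rintro _ ⟨Z, g, k, hg, hk, rfl⟩
    rw [add_comm]
    exact (of_rad hϖ hg).comp (ih hk)

end IsDivisible

theorem eq_zero_of_forall_pow_dvd {ϖ : S} (hϖ : Irreducible ϖ) {s : S}
    (h : ∀ n : ℕ, ϖ ^ (n + 1) ∣ s) : s = 0 := by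
  by_contra hs
  obtain ⟨n, hn⟩ := IsDiscreteValuationRing.associated_pow_irreducible hs hϖ
  have := (pow_dvd_pow_iff hϖ.ne_zero hϖ.not_isUnit).1 ((h n).trans hn.dvd)
  omega

end Divisibility

/-! ### The intersection of the finite powers -/

section Filtration

variable {S R : Type u} [CommRing S] [CommRing R] [IsLocalRing R] [Algebra S R]
  {e : R ≃ₐ[S] DualNumber S}

/-- The element `m` of `N` has a multiple in `εN` by a nonzero element of `S`. -/
def IsTorsionModEps (e : R ≃ₐ[S] DualNumber S) {N : FGCM R} (m : N.obj) : Prop :=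
  ∃ (s : S) (m' : N.obj), s ≠ 0 ∧ algebraMap S R s • m = eps e • m'

namespace IsTorsionModEps

variable {N : FGCM R}

theorem neg {m : N.obj} (h : IsTorsionModEps e m) : IsTorsionModEps e (-m) := by
  obtain ⟨s, k, hs, h⟩ := h
  exact ⟨s, -k, hs, by rw [smul_neg, smul_neg, h]⟩

theorem map {K : FGCM R} (f : N ⟶ K) {m : N.obj} (h : IsTorsionModEps e m) :
    IsTorsionModEps e (toLin f m) := by
  obtain ⟨s, k, hs, h⟩ := h
  exact ⟨s, toLin f k, hs, by rw [← map_smul, ← map_smul, h]⟩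

variable [IsDomain S]

theorem zero : IsTorsionModEps e (0 : N.obj) := ⟨1, 0, one_ne_zero, by simp⟩

theorem add {m m' : N.obj} (h : IsTorsionModEps e m) (h' : IsTorsionModEps e m') :
    IsTorsionModEps e (m + m') := by
  obtain ⟨s, k, hs, h⟩ := h
  obtain ⟨s', k', hs', h'⟩ := h'
  refine ⟨s * s', algebraMap S R s' • k + algebraMap S R s • k', mul_ne_zero hs hs', ?_⟩
  rw [map_mul, smul_add, smul_add, mul_comm, mul_smul, h, mul_comm, mul_smul, h',
    smul_comm (eps e), smul_comm (eps e)]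

end IsTorsionModEps

variable (e) in
/-- Morphisms that map everything into the kernel of `ε`, and the kernel of `ε` into the
elements that are torsion modulo the image of `ε`. On torsion-free modules this means shifting by
one step the filtration formed by the kernel of `ε` and the saturation of the image of `ε`. -/
structure ShiftsFiltration {M N : FGCM R} (f : M ⟶ N) : Prop where
  eps_smul : ∀ m, eps e • toLin f m = 0
  torsion : ∀ m, eps e • m = 0 → IsTorsionModEps e (toLin f m)

namespace ShiftsFiltration

variable {M N K L : FGCM R}

theorem neg {f : M ⟶ N} (hf : ShiftsFiltration e f) : ShiftsFiltration e (-f) where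
  eps_smul m := by rw [toLin_neg, LinearMap.neg_apply, smul_neg, hf.eps_smul, neg_zero]
  torsion m hm := (hf.torsion m hm).neg

theorem comp_left {f : M ⟶ N} (hf : ShiftsFiltration e f) (g : K ⟶ M) :
    ShiftsFiltration e (g ≫ f) where
  eps_smul m := hf.eps_smul _
  torsion m hm := hf.torsion _ (by rw [← map_smul, hm, map_zero])

theorem comp_right {f : M ⟶ N} (hf : ShiftsFiltration e f) (g : N ⟶ K) :
    ShiftsFiltration e (f ≫ g) where
  eps_smul m := by
    rw [toLin_comp, LinearMap.comp_apply, ← map_smul, hf.eps_smul, map_zero]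
  torsion m hm := (hf.torsion m hm).map g

variable [IsDomain S]

theorem zero : ShiftsFiltration e (0 : M ⟶ N) :=
  ⟨fun _ => smul_zero _, fun _ _ => IsTorsionModEps.zero⟩

theorem add {f g : M ⟶ N} (hf : ShiftsFiltration e f) (hg : ShiftsFiltration e g) :
    ShiftsFiltration e (f + g) where
  eps_smul m := by
    rw [toLin_add, LinearMap.add_apply, smul_add, hf.eps_smul, hg.eps_smul, add_zero]
  torsion m hm := (hf.torsion m hm).add (hg.torsion m hm)

variable [IsDiscreteValuationRing S]

/-- The filtration has three steps, so a composite of three morphisms that shift it is zero. -/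
theorem comp_comp_eq_zero {f : K ⟶ L} {g : L ⟶ M} {h : M ⟶ N} (hf : ShiftsFiltration e f)
    (hg : ShiftsFiltration e g) (hh : ShiftsFiltration e h) : f ≫ g ≫ h = 0 := by
  apply toLin_injective
  ext m
  obtain ⟨s, k, hs, hk⟩ := hg.torsion _ (hf.eps_smul m)
  have h0 : algebraMap S R s • toLin h (toLin g (toLin f m)) = 0 := by
    rw [← map_smul, hk, map_smul, hh.eps_smul]
  let _ : Module S N.obj := Module.restrictScalars S R N.obj
  have : IsScalarTower S R N.obj := IsScalarTower.restrictScalars S R N.obj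
  have : Module.IsTorsionFree S N.obj := (isMaximalCM_iff_isTorsionFree e _).1 N.property.2
  rw [algebraMap_smul] at h0
  exact (smul_eq_zero.1 h0).resolve_left hs

theorem of_line_line {f : lineObj e ⟶ lineObj e} (hf : Line.scalar (e := e) (toLin f) = 0) :
    ShiftsFiltration e f := by
  have hf0 : f = 0 := by
    apply toLin_injective
    refine LinearMap.ext fun s => ?_
    refine (Line.apply_eq (e := e) (toLin f) s).trans ?_
    rw [hf]
    exact zero_smul S (id s : Line e)
  rw [hf0]
  exact zero

theorem of_plane_line {a : S} (ha : a ≠ 0) (f : planeObj e a ⟶ lineObj e) :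
    ShiftsFiltration e f where
  eps_smul m := Line.eps_smul e _
  torsion m hm := by
    have hm' : Plane.mk (a * m.2, 0) = (0 : Plane e a) := by
      rw [← Plane.eps_smul]
      exact hm
    have hm2 : m.2 = 0 := (mul_eq_zero.1 (congrArg Prod.fst hm')).resolve_left ha
    have : toLin f m = 0 := by
      refine (Plane.apply_eq_add (toLin f) m).trans ?_
      rw [hm2, Plane.apply_one_zero_line ha]
      change m.1 • (0 : Line e) + (0 : S) • toLin f (Plane.mk (0, 1)) = (0 : Line e)
      rw [smul_zero, zero_add]
      exact zero_smul S (_ : Line e)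
    rw [this]
    exact IsTorsionModEps.zero

theorem of_line_plane {b : S} (hb : b ≠ 0) (f : lineObj e ⟶ planeObj e b) :
    ShiftsFiltration e f where
  eps_smul m := by
    rw [← map_smul]
    exact (congrArg (toLin f) (Line.eps_smul e m)).trans (map_zero _)
  torsion m _ := by
    refine ⟨b, (Plane.mk (0, (toLin f m).1) : Plane e b), hb, ?_⟩
    refine Eq.trans ?_ (Plane.eps_smul e b _).symm
    refine (algebraMap_smul (M := Plane e b) R b (toLin f m)).trans ?_
    refine Prod.ext rfl ?_
    change b * (toLin f m).2 = 0
    rw [Plane.line_apply_snd hb, mul_zero]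

theorem of_plane_plane {a b : S} (ha : a ≠ 0) (f : planeObj e a ⟶ planeObj e b)
    (hu : Plane.upper (toLin f) = 0) (hl : Plane.lower (toLin f) = 0) :
    ShiftsFiltration e f := by
  have hf (m : Plane e a) : toLin f m =
      (Plane.mk (Plane.corner (toLin f) * m.2, 0) : Plane e b) := by
    refine (Plane.apply_eq ha (toLin f) m).trans ?_
    rw [hu, hl, zero_mul, zero_mul, zero_add]
  refine ⟨fun m => ?_, fun m hm => ?_⟩
  · rw [hf]
    refine (Plane.eps_smul e b _).trans ?_
    exact Prod.ext (mul_zero b) rfl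
  · have hm' : Plane.mk (a * m.2, 0) = (0 : Plane e a) := by
      rw [← Plane.eps_smul]
      exact hm
    have hm2 : m.2 = 0 := (mul_eq_zero.1 (congrArg Prod.fst hm')).resolve_left ha
    have : toLin f m = 0 := by
      rw [hf, hm2, mul_zero]
      rfl
    rw [this]
    exact IsTorsionModEps.zero

/-- Morphisms in all finite powers of the radical have components with zero diagonal, by Krull's
intersection theorem in the discrete valuation ring `S`. -/
theorem of_forall_idealPow {f : M ⟶ N} (hf : ∀ n, idealPow (rad R) n f) :
    ShiftsFiltration e f := by
  obtain ⟨ϖ, hϖ⟩ := IsDiscreteValuationRing.exists_irreducible S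
  have hdiv (n : ℕ) : IsDivisible e ϖ (n + 1) f := IsDivisible.of_idealPow hϖ (hf (n + 1))
  have key (z : M ⟶ M) (w : N ⟶ N)
      (hz : z ∈ AddSubgroup.closure (standardFactorizations e M))
      (hw : w ∈ AddSubgroup.closure (standardFactorizations e N)) :
      ShiftsFiltration e (z ≫ f ≫ w) := by
    induction hz using AddSubgroup.closure_induction with
    | zero => simpa using zero
    | add y z _ _ hy hz => simpa using hy.add hz
    | neg z _ hz => simpa using hz.neg
    | mem z hz =>
      induction hw using AddSubgroup.closure_induction with
      | zero => simpa using zero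
      | add y z _ _ hy hz => simpa using hy.add hz
      | neg z _ hz => simpa using hz.neg
      | mem w hw =>
        have assoc {A B : FGCM R} (q : M ⟶ A) (r : A ⟶ M) (q' : N ⟶ B) (r' : B ⟶ N)
            (h : ShiftsFiltration e (r ≫ f ≫ q')) :
            ShiftsFiltration e ((q ≫ r) ≫ f ≫ q' ≫ r') := by
          simpa using (h.comp_left q).comp_right r'
        obtain ⟨a, ha, q, r, rfl⟩ | ⟨q, r, rfl⟩ := hz <;>
          obtain ⟨b, hb, q', r', rfl⟩ | ⟨q', r', rfl⟩ := hw
        · apply assoc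
          have h0 := eq_zero_of_forall_pow_dvd hϖ fun n => (hdiv n).plane ha hb r q'
          have hul := Plane.upper_mul (toLin (r ≫ f ≫ q'))
          -- Since `a * upper = b * lower`, either entry vanishes along with the other.
          have hl : Plane.lower (toLin (r ≫ f ≫ q')) = 0 := by
            obtain h | h := mul_eq_zero.1 h0
            · rw [h, mul_zero] at hul
              exact (mul_eq_zero.1 hul.symm).resolve_left hb
            · exact h
          have hu : Plane.upper (toLin (r ≫ f ≫ q')) = 0 := by
            rw [hl, mul_zero] at hul
            exact (mul_eq_zero.1 hul).resolve_left ha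
          exact of_plane_plane ha _ hu hl
        · exact assoc _ _ _ _ (of_plane_line ha _)
        · exact assoc _ _ _ _ (of_line_plane hb _)
        · exact assoc _ _ _ _ (of_line_line
            (eq_zero_of_forall_pow_dvd hϖ fun n => (hdiv n).line r q'))
  simpa using key _ _ (id_mem_closure_standardFactorizations e M)
    (id_mem_closure_standardFactorizations e N)

end ShiftsFiltration

end Filtration

/-! ### Long factorizations through the modules `Plane e a` -/

section Chains

variable {S R : Type u} [CommRing S] [CommRing R] [Algebra S R] (e : R ≃ₐ[S] DualNumber S)

/-- The homomorphism `(u, v) ↦ (c * u, d * v)`. -/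
def Plane.diag {a b : S} (c d : S) (h : c * a = b * d) : Plane e a →ₗ[R] Plane e b :=
  linearMapOfEps e (M := Plane e a) (N := Plane e b)
    ((LinearMap.lsmul S S c).prodMap (LinearMap.lsmul S S d)) (by
      intro p
      rw [Plane.eps_smul, Plane.eps_smul]
      refine Prod.ext ?_ ?_
      · change c * (a * p.2) = b * (d * p.2)
        rw [← mul_assoc, h, mul_assoc]
      · exact mul_zero d)

/-- The projection `(u, v) ↦ v`. -/
def Plane.toLine (a : S) : Plane e a →ₗ[R] Line e :=
  linearMapOfEps e (M := Plane e a) (N := Line e) (LinearMap.snd S S S) (by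
    intro p
    rw [Plane.eps_smul, Line.eps_smul]
    rfl)

/-- The inclusion `u ↦ (u, 0)`. -/
def Line.toPlane (b : S) : Line e →ₗ[R] Plane e b :=
  linearMapOfEps e (M := Line e) (N := Plane e b) (LinearMap.inl S S S) (by
    intro s
    rw [Plane.eps_smul, Line.eps_smul]
    exact Prod.ext (mul_zero b).symm rfl)

theorem Plane.toPlane_comp_toLine_ne_zero [Nontrivial S] (a b : S) :
    Line.toPlane e b ∘ₗ Plane.toLine e a ≠ 0 := fun h =>
  one_ne_zero (α := S) (congrArg Prod.fst (LinearMap.congr_fun h (Plane.mk (0, 1))))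

variable [IsDomain S] [IsDiscreteValuationRing S] [IsLocalRing R]

theorem rad_toLine {a : S} (ha : a ≠ 0) :
    rad R (ofLin (Plane.toLine e a) : planeObj e a ⟶ lineObj e) := by
  refine rad_of_not_isIso (hasTrivialIdempotents_planeObj e ha) (hasTrivialIdempotents_lineObj e)
    _ fun h => ?_
  have h0 : (Plane.mk (1, 0) : Plane e a) = 0 :=
    (injective_iff_map_eq_zero (Plane.toLine e a)).1 (bijective_of_isIso
      (ofLin (Plane.toLine e a) : planeObj e a ⟶ lineObj e)).1 _ rfl
  exact one_ne_zero (α := S) (congrArg Prod.fst h0)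

theorem rad_toPlane {b : S} (hb : b ≠ 0) :
    rad R (ofLin (Line.toPlane e b) : lineObj e ⟶ planeObj e b) := by
  refine rad_of_not_isIso (hasTrivialIdempotents_lineObj e) (hasTrivialIdempotents_planeObj e hb)
    _ fun h => ?_
  obtain ⟨s, hs⟩ := (bijective_of_isIso (ofLin (Line.toPlane e b) :
    lineObj e ⟶ planeObj e b)).2 (Plane.mk (0, 1) : Plane e b)
  exact zero_ne_one (α := S) (congrArg Prod.snd hs)

theorem rad_diag {a b : S} (ha : a ≠ 0) (hb : b ≠ 0) (c d : S) (h : c * a = b * d)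
    (hcd : ¬ (IsUnit c ∧ IsUnit d)) :
    rad R (ofLin (Plane.diag e c d h) : planeObj e a ⟶ planeObj e b) := by
  refine rad_of_not_isIso (hasTrivialIdempotents_planeObj e ha)
    (hasTrivialIdempotents_planeObj e hb) _ fun _ => hcd ?_
  obtain ⟨p, hp⟩ := (bijective_of_isIso (ofLin (Plane.diag e c d h) :
    planeObj e a ⟶ planeObj e b)).2 (Plane.mk (1, 1) : Plane e b)
  exact ⟨IsUnit.of_mul_eq_one _ (congrArg Prod.fst hp),
    IsUnit.of_mul_eq_one _ (congrArg Prod.snd hp)⟩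

/-- The projection `Plane e a → Line e` factors through arbitrarily long chains
`Plane e a → Plane e (ϖ * a) → Plane e (ϖ ^ 2 * a) → ⋯`. -/
theorem idealPow_toLine_comp {a : S} (ha : a ≠ 0) {Y : FGCM R} (h : lineObj e ⟶ Y) (n : ℕ) :
    idealPow (rad R) n ((ofLin (Plane.toLine e a) : planeObj e a ⟶ lineObj e) ≫ h) := by
  obtain ⟨ϖ, hϖ⟩ := IsDiscreteValuationRing.exists_irreducible S
  obtain _ | n := n
  · exact trivial
  induction n generalizing a with
  | zero => exact rad_comp _ _ (rad_toLine e ha)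
  | succ n ih =>
    have hb : ϖ * a ≠ 0 := mul_ne_zero hϖ.ne_zero ha
    refine AddSubgroup.subset_closure
      ⟨_, ofLin (Plane.diag e ϖ 1 (mul_one (ϖ * a)).symm), _, ?_, ih hb, ?_⟩
    · exact rad_diag e ha hb _ _ _ fun h => hϖ.not_isUnit h.1
    · rw [← Category.assoc]
      congr 1
      apply toLin_injective
      refine LinearMap.ext fun p => ?_
      exact one_mul (M := S) (Prod.snd p)

theorem idealPow_diag {ϖ : S} (hϖ : Irreducible ϖ) (n : ℕ) {a b : S} (ha : a ≠ 0) (hb : b ≠ 0)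
    (h : 1 * a = b * ϖ ^ (n + 1)) : idealPow (rad R) (n + 1)
      (ofLin (Plane.diag e 1 (ϖ ^ (n + 1)) h) : planeObj e a ⟶ planeObj e b) := by
  have hϖn (n : ℕ) : ¬ IsUnit (ϖ ^ (n + 1)) := fun h =>
    hϖ.not_isUnit ((isUnit_pow_iff (Nat.succ_ne_zero n)).1 h)
  induction n generalizing a with
  | zero => exact rad_diag e ha hb _ _ _ fun h => hϖn 0 h.2
  | succ n ih =>
    have hc : b * ϖ ^ (n + 1) ≠ 0 := mul_ne_zero hb (pow_ne_zero _ hϖ.ne_zero)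
    refine AddSubgroup.subset_closure
      ⟨planeObj e (b * ϖ ^ (n + 1)), ofLin (Plane.diag e 1 ϖ (by rw [h]; ring)), _, ?_,
        ih hc (one_mul _), ?_⟩
    · exact rad_diag e ha hc _ _ _ fun h => hϖ.not_isUnit h.2
    · apply toLin_injective
      refine LinearMap.ext fun p => Prod.ext ?_ ?_
      · exact one_mul (M := S) _
      · change ϖ ^ (n + 1) * (ϖ * p.2) = ϖ ^ (n + 1 + 1) * p.2
        ring

/-- The inclusion `Line e → Plane e b` factors through arbitrarily long chains
`⋯ → Plane e (b * ϖ ^ 2) → Plane e (b * ϖ) → Plane e b`. -/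
theorem idealPow_toPlane {b : S} (hb : b ≠ 0) (n : ℕ) :
    idealPow (rad R) n (ofLin (Line.toPlane e b) : lineObj e ⟶ planeObj e b) := by
  obtain ⟨ϖ, hϖ⟩ := IsDiscreteValuationRing.exists_irreducible S
  obtain _ | _ | n := n
  · exact trivial
  · exact rad_toPlane e hb
  · have hc : b * ϖ ^ (n + 1) ≠ 0 := mul_ne_zero hb (pow_ne_zero _ hϖ.ne_zero)
    refine AddSubgroup.subset_closure
      ⟨planeObj e (b * ϖ ^ (n + 1)), ofLin (Line.toPlane e _), _, rad_toPlane e hc,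
        idealPow_diag e hϖ n hc hb (one_mul _), ?_⟩
    apply toLin_injective
    exact LinearMap.ext fun s => Prod.ext (one_mul (M := S) _) (mul_zero _)

end Chains

/-! ### Transfinite powers of the radical -/

section Transfinite

theorem ordinalPow_omega0_iff {C : Type u} [Category.{v} C] [Preadditive C]
    (I : MorphismProperty C) {X Y : C} (f : X ⟶ Y) :
    ordinalPow I Ordinal.omega0 f ↔ ∀ n : ℕ, idealPow I n f := by
  rw [ordinalPow_limit I Ordinal.isSuccLimit_omega0]
  rw [MorphismProperty.iInf_iff]
  constructor
  · intro h n
    rw [← ordinalPow_natCast]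
    exact h ⟨n, Ordinal.natCast_lt_omega0 n⟩
  · rintro h ⟨k, hk⟩
    obtain ⟨n, rfl⟩ := Ordinal.lt_omega0.1 hk
    rw [ordinalPow_natCast]
    exact h n

theorem ordinalPow_omega0_add_one {C : Type u} [Category.{v} C] [Preadditive C]
    (I : MorphismProperty C) : ordinalPow I (Ordinal.omega0 + 1) =
      idealMul (ordinalPow I Ordinal.omega0) (ordinalPow I Ordinal.omega0) := by
  have := ordinalPow_limit_add I Ordinal.isSuccLimit_omega0 1
  rwa [Nat.cast_one] at this

theorem ordinalPow_omega0_add_two {C : Type u} [Category.{v} C] [Preadditive C]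
    (I : MorphismProperty C) : ordinalPow I (Ordinal.omega0 + 2) =
      idealMul (idealMul (ordinalPow I Ordinal.omega0) (ordinalPow I Ordinal.omega0))
        (ordinalPow I Ordinal.omega0) := by
  have := ordinalPow_limit_add I Ordinal.isSuccLimit_omega0 2
  rwa [Nat.cast_ofNat] at this

theorem isZeroClass_idealMul_idealMul {C : Type u} [Category.{v} C] [Preadditive C]
    (I : MorphismProperty C) (hI : ∀ ⦃W X Y Z : C⦄ (f : W ⟶ X) (g : X ⟶ Y) (h : Y ⟶ Z),
      I f → I g → I h → f ≫ g ≫ h = 0) : IsZeroClass (idealMul (idealMul I I) I) := by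
  have hclosure {X Y : C} (s : Set (X ⟶ Y)) (hs : ∀ f ∈ s, f = 0) (f : X ⟶ Y)
      (hf : f ∈ AddSubgroup.closure s) : f = 0 := by
    have : AddSubgroup.closure s ≤ ⊥ := (AddSubgroup.closure_le _).2 hs
    exact this hf
  intro X Y f hf
  refine hclosure _ ?_ f hf
  rintro _ ⟨Z, g, k, hg, hk, rfl⟩
  induction hk using AddSubgroup.closure_induction with
  | zero => exact Limits.comp_zero
  | add k k' _ _ hk hk' => rw [Preadditive.comp_add, hk, hk', add_zero]
  | neg k _ hk => rw [Preadditive.comp_neg, hk, neg_zero]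
  | mem k hk =>
    obtain ⟨W, h, l, hh, hl, rfl⟩ := hk
    exact hI g h l hg hh hl

variable {S R : Type u} [CommRing S] [IsDomain S] [IsDiscreteValuationRing S] [CommRing R]
  [IsLocalRing R] [Algebra S R]

/-- The composite `Plane e 1 → Line e → Plane e 1` lies in every power of the radical below
`ω + 2`. -/
theorem not_isZeroClass_ordinalPow (e : R ≃ₐ[S] DualNumber S) (l : Ordinal.{0})
    (hl : l < Ordinal.omega0 + 2) :
    ¬ IsZeroClass (ordinalPow (rad R) l) := by
  intro hzero
  let f : planeObj e 1 ⟶ lineObj e := ofLin (Plane.toLine e 1)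
  let g : lineObj e ⟶ planeObj e 1 := ofLin (Line.toPlane e 1)
  have hne : f ≫ g ≠ 0 := fun h => Plane.toPlane_comp_toLine_ne_zero e 1 1 (congrArg toLin h)
  refine hne (hzero _ ?_)
  have hf {Y : FGCM R} (h : lineObj e ⟶ Y) : ordinalPow (rad R) Ordinal.omega0 (f ≫ h) :=
    (ordinalPow_omega0_iff _ _).2 fun n => idealPow_toLine_comp e one_ne_zero h n
  have hg : ordinalPow (rad R) Ordinal.omega0 g :=
    (ordinalPow_omega0_iff _ _).2 fun n => idealPow_toPlane e one_ne_zero n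
  have hl' : l ≤ Ordinal.omega0 + 1 := by
    rwa [← Order.lt_add_one_iff, add_assoc, one_add_one_eq_two]
  obtain rfl | hl' := hl'.eq_or_lt
  · rw [ordinalPow_omega0_add_one]
    have hf1 := hf (𝟙 _)
    rw [Category.comp_id] at hf1
    exact AddSubgroup.subset_closure ⟨_, f, g, hf1, hg, rfl⟩
  obtain rfl | hl' := (Order.lt_add_one_iff.1 hl').eq_or_lt
  · exact hf g
  · obtain ⟨n, rfl⟩ := Ordinal.lt_omega0.1 hl'
    rw [ordinalPow_natCast]
    exact (ordinalPow_omega0_iff _ _).1 (hf g) n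

theorem isZeroClass_ordinalPow_omega0_add_two (e : R ≃ₐ[S] DualNumber S) :
    IsZeroClass (ordinalPow (rad R) (Ordinal.omega0 + 2)) := by
  rw [ordinalPow_omega0_add_two]
  have hshift {X Y : FGCM R} (f : X ⟶ Y) (hf : ordinalPow (rad R) Ordinal.omega0 f) :
      ShiftsFiltration e f :=
    ShiftsFiltration.of_forall_idealPow ((ordinalPow_omega0_iff _ _).1 hf)
  exact isZeroClass_idealMul_idealMul _ fun _ _ _ _ f g h hf hg hh =>
    (hshift f hf).comp_comp_eq_zero (hshift g hg) (hshift h hh)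

end Transfinite

end AInfinity

end

theorem theorem8p4 (F : Type u) [Field F] [IsAlgClosed F] (hF : ringChar F ≠ 2) :
    AInfinity.HasNilpotencyIndex (AInfinity.rad (AInfinity.AInfRing F)) (Ordinal.omega0 + 2) ∧
    AInfinity.ordinalPow (AInfinity.rad (AInfinity.AInfRing F)) (Ordinal.omega0 + 1) =
      AInfinity.idealMul
        (AInfinity.ordinalPow (AInfinity.rad (AInfinity.AInfRing F)) Ordinal.omega0)
        (AInfinity.ordinalPow (AInfinity.rad (AInfinity.AInfRing F)) Ordinal.omega0) ∧
    ¬ AInfinity.IsZeroClass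
      (AInfinity.ordinalPow (AInfinity.rad (AInfinity.AInfRing F)) (Ordinal.omega0 + 1)) ∧
    AInfinity.IsZeroClass
      (AInfinity.ordinalPow (AInfinity.rad (AInfinity.AInfRing F)) (Ordinal.omega0 + 2)) := by
  obtain ⟨_, ⟨e⟩⟩ := AInfinity.exists_algEquiv_dualNumber F
  have hzero := AInfinity.isZeroClass_ordinalPow_omega0_add_two e
  have hne := AInfinity.not_isZeroClass_ordinalPow e
  refine ⟨⟨hzero, fun l hl => not_lt.1 fun h => hne l h hl⟩,
    AInfinity.ordinalPow_omega0_add_one _, hne _ ?_, hzero⟩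
  rw [← one_add_one_eq_two, ← add_assoc]
  exact Order.lt_add_one_iff.2 le_rfl
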